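/- Corollary 2.6 (Wiener chaos estimate). There is an absolute constant $C>0$ with the following property. Let $S$ be a finite set, let $(g_s)_{s\in S}$ be independent real Gaussian random variables of mean zero and variance one, let $k\ge 0$ be an integer, let $H$ be a finite-dimensional complex Hilbert space, and for each subset $A\subseteq S$ with $|A|\le k$ let $c_A\in H$. Then for every real $2\le p<\infty$ the random variable $\bigl\|\sum_{A\subseteq S,\,|A|\le k} c_A\prod_{s\in A} g_s\bigr\|_H^p$ is integrable and $$\mathbb{E}\Bigl\|\sum_{A\subseteq S,\ |A|\le k} c_A\prod_{s\in A} g_s\Bigr\|_H^p \le (Cp)^{kp/2}\Bigl(\sum_{A\subseteq S,\ |A|\le k}\|c_A\|_H^2\Bigr)^{p/2}.$$ -/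

import Mathlib

open MeasureTheory ProbabilityTheory

/-! Gaussian hypercontractivity for even exponents, one variable at a time. Comparing binomial
expansions bounds `E (x + t y)^(2m)` by `(x² + 2m y²)^m`; convexity and the symmetry of `t` carry
this to vectors. Integrating out a variable thus replaces `a + t • b` by the vector `(a, √(2m) b)`
of the Hilbert sum `H × H`, a multilinear polynomial in fewer variables, so induction gives each `‖c
A‖²` the weight `(2m)^|A| ≤ (2m)^k`. Monotonicity of `L^p` norms then passes from `2m` to real `p`.
-/

/-! ### Gaussian moments and the scalar inequality -/

theorem integrable_pow_gaussianReal (n : ℕ) :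
    Integrable (fun x : ℝ ↦ x ^ n) (gaussianReal 0 1) := by
  rcases eq_or_ne n 0 with rfl | hn
  · simp
  · have h := (memLp_id_gaussianReal (μ := 0) (v := 1) (n : NNReal)).integrable_norm_rpow
      (by simpa using hn) (by simp)
    refine (integrable_norm_iff (by fun_prop)).1 (h.congr (ae_of_all _ fun x ↦ ?_))
    simp

theorem integral_pow_gaussianReal_eq (n : ℕ) :
    ∫ x, x ^ n ∂(gaussianReal 0 1)
      = (√(2 * Real.pi))⁻¹ * ∫ x : ℝ, x ^ n * Real.exp (-(1 / 2) * x ^ 2) := by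
  rw [integral_gaussianReal_eq_integral_smul (by simp), ← integral_const_mul]
  congr 1 with x
  simp only [gaussianPDFReal, smul_eq_mul, NNReal.coe_one, mul_one, sub_zero]
  rw [show -x ^ 2 / 2 = -(1 / 2) * x ^ 2 by ring]
  ring

theorem integrable_pow_mul_exp_neg_half_sq (n : ℕ) :
    Integrable fun x : ℝ ↦ x ^ n * Real.exp (-(1 / 2) * x ^ 2) := by
  simpa using integrable_rpow_mul_exp_neg_mul_sq (b := 1 / 2) (by norm_num) (s := n)
    (by linarith [n.cast_nonneg (α := ℝ)])

theorem integral_pow_add_two_gaussianReal (n : ℕ) :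
    ∫ x, x ^ (n + 2) ∂(gaussianReal 0 1) = (n + 1) * ∫ x, x ^ n ∂(gaussianReal 0 1) := by
  have hi := integrable_pow_mul_exp_neg_half_sq
  have hd : ∀ x : ℝ, HasDerivAt (fun x : ℝ ↦ x ^ (n + 1) * Real.exp (-(1 / 2) * x ^ 2))
      ((n + 1) * (x ^ n * Real.exp (-(1 / 2) * x ^ 2))
        - x ^ (n + 2) * Real.exp (-(1 / 2) * x ^ 2)) x := by
    intro x
    have h1 := (hasDerivAt_pow (n + 1) x).mul (((hasDerivAt_pow 2 x).const_mul (-(1 / 2))).exp)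
    refine h1.congr_deriv ?_
    simp only [Nat.add_sub_cancel]
    push_cast
    ring
  have h0 := integral_eq_zero_of_hasDerivAt_of_integrable hd
    (((hi n).const_mul _).sub (hi (n + 2))) (hi (n + 1))
  rw [integral_sub ((hi n).const_mul _) (hi (n + 2)), integral_const_mul] at h0
  rw [integral_pow_gaussianReal_eq, integral_pow_gaussianReal_eq]
  linear_combination -(√(2 * Real.pi))⁻¹ * h0

theorem integral_odd_pow_gaussianReal (j : ℕ) :
    ∫ x, x ^ (2 * j + 1) ∂(gaussianReal 0 1) = 0 := by
  induction j with
  | zero => simp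
  | succ j ih =>
    rw [show 2 * (j + 1) + 1 = (2 * j + 1) + 2 by ring, integral_pow_add_two_gaussianReal, ih,
      mul_zero]

theorem integral_even_pow_gaussianReal (j : ℕ) :
    (2 ^ j * j.factorial : ℝ) * ∫ x, x ^ (2 * j) ∂(gaussianReal 0 1) = (2 * j).factorial := by
  induction j with
  | zero => simp
  | succ j ih =>
    rw [show 2 * (j + 1) = 2 * j + 2 by ring, integral_pow_add_two_gaussianReal]
    simp only [Nat.factorial_succ]
    push_cast
    rw [← ih]
    ring

/-- Factors are taken in pairs: `(2m - 2j)(2m - 2j - 1) ≤ 2(m - j) · 2m`. -/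
theorem descFactorial_two_mul_le (m j : ℕ) :
    (2 * m).descFactorial (2 * j) ≤ 2 ^ j * m.descFactorial j * (2 * m) ^ j := by
  induction j with
  | zero => simp
  | succ j ih =>
    rw [show 2 * (j + 1) = 2 * j + 1 + 1 by ring, Nat.descFactorial_succ, Nat.descFactorial_succ,
      Nat.descFactorial_succ]
    calc (2 * m - (2 * j + 1)) * ((2 * m - 2 * j) * (2 * m).descFactorial (2 * j))
        ≤ (2 * m) * ((2 * (m - j)) * (2 ^ j * m.descFactorial j * (2 * m) ^ j)) := by
          gcongr <;> omega
      _ = _ := by ring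

theorem choose_mul_integral_even_pow_le (m j : ℕ) :
    ((2 * m).choose (2 * j) : ℝ) * ∫ x, x ^ (2 * j) ∂(gaussianReal 0 1)
      ≤ m.choose j * (2 * m) ^ j := by
  have h1 : ((2 * m).descFactorial (2 * j) : ℝ) ≤ 2 ^ j * m.descFactorial j * (2 * m) ^ j := by
    exact_mod_cast descFactorial_two_mul_le m j
  rw [Nat.descFactorial_eq_factorial_mul_choose, Nat.descFactorial_eq_factorial_mul_choose] at h1
  push_cast at h1
  rw [← integral_even_pow_gaussianReal] at h1
  have hp : (0 : ℝ) < 2 ^ j * j.factorial := by positivity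
  refine le_of_mul_le_mul_left ?_ hp
  linarith

theorem sum_range_two_mul_add_one_of_odd_eq_zero {M : Type*} [AddCommMonoid M] (f : ℕ → M)
    (hf : ∀ j, f (2 * j + 1) = 0) (m : ℕ) :
    ∑ i ∈ Finset.range (2 * m + 1), f i = ∑ j ∈ Finset.range (m + 1), f (2 * j) := by
  induction m with
  | zero => simp
  | succ m ih =>
    rw [show 2 * (m + 1) + 1 = 2 * m + 1 + 1 + 1 by ring, Finset.sum_range_succ,
      Finset.sum_range_succ, ih, hf, add_zero, Finset.sum_range_succ _ (m + 1)]
    rfl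

theorem integrable_add_mul_pow_gaussianReal (x y : ℝ) (n : ℕ) :
    Integrable (fun t ↦ (x + t * y) ^ n) (gaussianReal 0 1) := by
  simp only [add_pow, mul_pow]
  exact integrable_finsetSum _ fun i _ ↦
    ((((integrable_pow_gaussianReal _).mul_const _).const_mul _).mul_const _)

/-- Scalar one-variable hypercontractivity for an even exponent. -/
theorem integral_add_mul_pow_gaussianReal_le (x y : ℝ) (m : ℕ) :
    ∫ t, (x + t * y) ^ (2 * m) ∂(gaussianReal 0 1) ≤ (x ^ 2 + 2 * m * y ^ 2) ^ m := by
  have h : ∫ t, (x + t * y) ^ (2 * m) ∂(gaussianReal 0 1)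
      = ∑ i ∈ Finset.range (2 * m + 1),
        y ^ i * x ^ (2 * m - i) * (((2 * m).choose i : ℝ) * ∫ t, t ^ i ∂(gaussianReal 0 1)) := by
    simp only [add_comm x, add_pow, mul_pow]
    rw [integral_finsetSum _ fun i _ ↦
      (((integrable_pow_gaussianReal i).mul_const _).mul_const _).mul_const _]
    refine Finset.sum_congr rfl fun i _ ↦ ?_
    rw [integral_mul_const, integral_mul_const, integral_mul_const]
    ring
  rw [h, sum_range_two_mul_add_one_of_odd_eq_zero _ (fun j ↦ by
    rw [integral_odd_pow_gaussianReal]; simp), add_comm (x ^ 2), add_pow]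
  -- Only even moments survive, and the two binomial expansions compare term by term.
  refine Finset.sum_le_sum fun j hj ↦ ?_
  rw [← Nat.mul_sub, pow_mul, pow_mul, mul_pow]
  have := mul_le_mul_of_nonneg_left (choose_mul_integral_even_pow_le m j)
    (by positivity : 0 ≤ (y ^ 2) ^ j * (x ^ 2) ^ (m - j))
  linarith

/-- `u + v` and `u - v` are convex combinations of `u ± w` with swapped weights; `w ≤ u` keeps these
points where `x ^ m` is convex. -/
theorem add_pow_add_sub_pow_le {u v w : ℝ} (hv : |v| ≤ w) (hw : w ≤ u) (m : ℕ) :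
    (u + v) ^ m + (u - v) ^ m ≤ (u + w) ^ m + (u - w) ^ m := by
  obtain ⟨h1, h2⟩ := abs_le.1 hv
  rcases (show 0 ≤ w by linarith [abs_nonneg v]).eq_or_lt with rfl | hw0
  · have : v = 0 := by linarith
    simp [this]
  have hc := (convexOn_pow (𝕜 := ℝ) m).2 (show 0 ≤ u + w by linarith) (show 0 ≤ u - w by linarith)
  have e1 := hc (a := (w + v) / (2 * w)) (b := (w - v) / (2 * w))
    (div_nonneg (by linarith) (by linarith)) (div_nonneg (by linarith) (by linarith))
    (by field_simp; ring)
  have e2 := hc (a := (w - v) / (2 * w)) (b := (w + v) / (2 * w))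
    (div_nonneg (by linarith) (by linarith)) (div_nonneg (by linarith) (by linarith))
    (by field_simp; ring)
  have f1 : (w + v) / (2 * w) * (u + w) + (w - v) / (2 * w) * (u - w) = u + v := by
    field_simp; ring
  have f2 : (w - v) / (2 * w) * (u + w) + (w + v) / (2 * w) * (u - w) = u - v := by
    field_simp; ring
  simp only [smul_eq_mul] at e1 e2
  rw [f1] at e1
  rw [f2] at e2
  have f3 : (w + v) / (2 * w) + (w - v) / (2 * w) = 1 := by field_simp; ring
  calc _ ≤ _ := add_le_add e1 e2
    _ = ((w + v) / (2 * w) + (w - v) / (2 * w)) * ((u + w) ^ m + (u - w) ^ m) := by ring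
    _ = _ := by rw [f3, one_mul]

/-! ### Passage to Hilbert space vectors -/

section InnerProduct

variable {H : Type*} [NormedAddCommGroup H] [InnerProductSpace ℝ H]

/-- The squares `‖a ± b‖²` have the form `u ± v` with `v = 2⟨a, b⟩`, and Cauchy–Schwarz bounds `|v|`
by `2‖a‖‖b‖`. -/
theorem norm_add_pow_add_norm_sub_pow_le (a b : H) (m : ℕ) :
    ‖a + b‖ ^ (2 * m) + ‖a - b‖ ^ (2 * m)
      ≤ (‖a‖ + ‖b‖) ^ (2 * m) + (‖a‖ - ‖b‖) ^ (2 * m) := by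
  have h := add_pow_add_sub_pow_le (u := ‖a‖ ^ 2 + ‖b‖ ^ 2) (v := 2 * inner ℝ a b)
    (w := 2 * (‖a‖ * ‖b‖)) (by
      rw [abs_mul, abs_two]
      exact mul_le_mul_of_nonneg_left (abs_real_inner_le_norm a b) two_pos.le)
    (by nlinarith [sq_nonneg (‖a‖ - ‖b‖)]) m
  simp only [pow_mul]
  rw [norm_add_sq_real, norm_sub_sq_real]
  convert h using 3 <;> ring

theorem integral_comp_neg_gaussianReal (f : ℝ → ℝ) :
    ∫ t, f (-t) ∂(gaussianReal 0 1) = ∫ t, f t ∂(gaussianReal 0 1) := by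
  conv_rhs => rw [← neg_zero, ← gaussianReal_map_neg]
  exact ((MeasurableEquiv.neg ℝ).measurableEmbedding.integral_map f).symm

theorem integrable_norm_add_smul_pow_gaussianReal (a b : H) (n : ℕ) :
    Integrable (fun t : ℝ ↦ ‖a + t • b‖ ^ n) (gaussianReal 0 1) := by
  have h0 : Integrable (fun t : ℝ ↦ (‖a‖ + |t| * ‖b‖) ^ n) (gaussianReal 0 1) := by
    simp only [add_pow, mul_pow]
    refine integrable_finsetSum _ fun i _ ↦
      ((((?_ : Integrable (fun t : ℝ ↦ |t| ^ (n - i)) _).mul_const _).const_mul _).mul_const _)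
    simpa [abs_pow] using (integrable_pow_gaussianReal (n - i)).abs
  refine h0.mono'
    (Continuous.aestronglyMeasurable (by fun_prop)) (ae_of_all _ fun t ↦ ?_)
  rw [Real.norm_of_nonneg (by positivity)]
  gcongr
  calc ‖a + t • b‖ ≤ ‖a‖ + ‖t • b‖ := norm_add_le _ _
    _ = _ := by rw [norm_smul, Real.norm_eq_abs]

/-- Vector-valued one-variable hypercontractivity for an even exponent. -/
theorem integral_norm_add_smul_pow_gaussianReal_le (a b : H) (m : ℕ) :
    ∫ t : ℝ, ‖a + t • b‖ ^ (2 * m) ∂(gaussianReal 0 1)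
      ≤ (‖a‖ ^ 2 + 2 * m * ‖b‖ ^ 2) ^ m := by
  refine le_trans ?_ (integral_add_mul_pow_gaussianReal_le ‖a‖ ‖b‖ m)
  have i1 := integrable_norm_add_smul_pow_gaussianReal a b (2 * m)
  have i2 : Integrable (fun t : ℝ ↦ ‖a + (-t) • b‖ ^ (2 * m)) (gaussianReal 0 1) := by
    simpa using integrable_norm_add_smul_pow_gaussianReal a (-b) (2 * m)
  have j1 := integrable_add_mul_pow_gaussianReal ‖a‖ ‖b‖ (2 * m)
  have j2 : Integrable (fun t : ℝ ↦ (‖a‖ + (-t) * ‖b‖) ^ (2 * m)) (gaussianReal 0 1) := by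
    simpa using integrable_add_mul_pow_gaussianReal ‖a‖ (-‖b‖) (2 * m)
  have e1 := integral_comp_neg_gaussianReal fun t ↦ ‖a + t • b‖ ^ (2 * m)
  have e2 := integral_comp_neg_gaussianReal fun t ↦ (‖a‖ + t * ‖b‖) ^ (2 * m)
  -- The pointwise comparison holds only for the sum over `t` and `-t`; each integral is invariant
  -- under this reflection.
  have key := integral_mono (i1.add i2) (j1.add j2) fun t ↦ by
    have h := norm_add_pow_add_norm_sub_pow_le a (t • b) m
    simp only [Pi.add_apply, neg_smul, neg_mul, ← sub_eq_add_neg]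
    refine h.trans_eq ?_
    rw [norm_smul, Real.norm_eq_abs]
    rcases abs_choice t with ht | ht
    · rw [ht]
    · rw [ht]
      ring
  rw [integral_add' i1 i2, integral_add' j1 j2, e1, e2] at key
  linarith

theorem lintegral_norm_add_smul_pow_gaussianReal_le (a b : H) (m : ℕ) :
    ∫⁻ t : ℝ, ENNReal.ofReal (‖a + t • b‖ ^ (2 * m)) ∂(gaussianReal 0 1)
      ≤ ENNReal.ofReal ((‖a‖ ^ 2 + 2 * m * ‖b‖ ^ 2) ^ m) := by
  rw [← ofReal_integral_eq_lintegral_ofReal (integrable_norm_add_smul_pow_gaussianReal a b _)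
    (ae_of_all _ fun _ ↦ by positivity)]
  exact ENNReal.ofReal_le_ofReal (integral_norm_add_smul_pow_gaussianReal_le a b m)

end InnerProduct

/-- Hypercontractivity for multilinear Gaussian polynomials, for an even exponent: the
variables in `T` are integrated out. -/
theorem lmarginal_norm_multilinear_pow_le {S : Type*} [Countable S] [DecidableEq S] (m : ℕ)
    (T : Finset S)
    (x : S → ℝ) : ∀ {H : Type*} [NormedAddCommGroup H] [InnerProductSpace ℝ H]
    (c : Finset S → H),
    (∫⋯∫⁻_T, (fun y : S → ℝ ↦ ENNReal.ofReal
        (‖∑ A ∈ T.powerset, (∏ s ∈ A, y s) • c A‖ ^ (2 * m))) ∂fun _ : S ↦ gaussianReal 0 1) x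
      ≤ ENNReal.ofReal ((∑ A ∈ T.powerset, (2 * m) ^ A.card * ‖c A‖ ^ 2) ^ m) := by
  induction T using Finset.induction_on with
  | empty =>
    intro H _ _ c
    simp [pow_mul]
  | insert i T hi ih =>
    intro H _ _ c
    have hmeas : Measurable fun y : S → ℝ ↦ ENNReal.ofReal
        (‖∑ A ∈ (insert i T).powerset, (∏ s ∈ A, y s) • c A‖ ^ (2 * m)) :=
      (Continuous.measurable (by fun_prop)).ennreal_ofReal
    have hnot : ∀ A ∈ T.powerset, i ∉ A := fun A hA hiA ↦ hi (Finset.mem_powerset.1 hA hiA)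
    rw [lmarginal_insert' _ hmeas hi]
    -- The new coefficients live in a larger space, so the induction must quantify over `H`.
    let d : Finset S → WithLp 2 (H × H) := fun A ↦
      WithLp.toLp 2 (c A, √(2 * m) • c (insert i A))
    have hd : ∀ u v : H, ‖(WithLp.toLp 2 (u, √(2 * m) • v) : WithLp 2 (H × H))‖ ^ 2
        = ‖u‖ ^ 2 + 2 * m * ‖v‖ ^ 2 := by
      intro u v
      rw [WithLp.prod_norm_sq_eq_of_L2]
      simp [norm_smul, mul_pow]
    have hstep : (fun y : S → ℝ ↦ ∫⁻ t, ENNReal.ofReal (‖∑ A ∈ (insert i T).powerset,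
          (∏ s ∈ A, Function.update y i t s) • c A‖ ^ (2 * m)) ∂(gaussianReal 0 1))
        ≤ fun y ↦ ENNReal.ofReal (‖∑ A ∈ T.powerset, (∏ s ∈ A, y s) • d A‖ ^ (2 * m)) := by
      intro y
      have e0 : ∀ t : ℝ, ∑ A ∈ (insert i T).powerset, (∏ s ∈ A, Function.update y i t s) • c A
          = ∑ A ∈ T.powerset, (∏ s ∈ A, y s) • c A
            + t • ∑ A ∈ T.powerset, (∏ s ∈ A, y s) • c (insert i A) := by
        intro t
        have hu : ∀ A ∈ T.powerset, ∏ s ∈ A, Function.update y i t s = ∏ s ∈ A, y s :=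
          fun A hA ↦ Finset.prod_congr rfl fun s hs ↦
            Function.update_of_ne (ne_of_mem_of_not_mem hs (hnot A hA)) _ _
        rw [Finset.sum_powerset_insert hi, Finset.smul_sum]
        congr 1
        · exact Finset.sum_congr rfl fun A hA ↦ by rw [hu A hA]
        · refine Finset.sum_congr rfl fun A hA ↦ ?_
          rw [Finset.prod_insert (hnot A hA), hu A hA, Function.update_self, mul_smul]
      have e1 : ∑ A ∈ T.powerset, (∏ s ∈ A, y s) • d A
          = WithLp.toLp 2 (∑ A ∈ T.powerset, (∏ s ∈ A, y s) • c A,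
            √(2 * m) • ∑ A ∈ T.powerset, (∏ s ∈ A, y s) • c (insert i A)) := by
        apply (WithLp.equiv 2 (H × H)).injective
        simp only [WithLp.equiv_apply, d, WithLp.ofLp_sum, WithLp.ofLp_smul]
        ext
        · simp [Prod.fst_sum]
        · simp only [Prod.snd_sum, Prod.smul_snd, Finset.smul_sum]
          exact Finset.sum_congr rfl fun A _ ↦ smul_comm _ _ _
      simp only [e0]
      refine (lintegral_norm_add_smul_pow_gaussianReal_le _ _ m).trans_eq ?_
      rw [e1, pow_mul, hd]
    refine (lmarginal_mono hstep x).trans ((ih d).trans_eq ?_)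
    rw [Finset.sum_powerset_insert hi, ← Finset.sum_add_distrib]
    congr 2
    refine Finset.sum_congr rfl fun A hA ↦ ?_
    rw [hd, Finset.card_insert_of_notMem (hnot A hA)]
    ring

/-! ### Chaos of bounded degree and real exponents -/

section Chaos

variable {Ω : Type*} [MeasurableSpace Ω] {P : Measure Ω}
  {S : Type*} [Fintype S] {H : Type*} [NormedAddCommGroup H] [InnerProductSpace ℝ H]

theorem lintegral_norm_gaussian_multilinear_pow_le [DecidableEq S] {g : S → Ω → ℝ}
    (hg : ∀ s, HasLaw (g s) (gaussianReal 0 1) P) (hind : iIndepFun g P) (m : ℕ)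
    (c : Finset S → H) :
    ∫⁻ ω, ENNReal.ofReal (‖∑ A, (∏ s ∈ A, g s ω) • c A‖ ^ (2 * m)) ∂P
      ≤ ENNReal.ofReal ((∑ A, (2 * m) ^ A.card * ‖c A‖ ^ 2) ^ m) := by
  have hae : ∀ s, AEMeasurable (g s) P := fun s ↦ (hg s).aemeasurable
  have hmap := hind.map_fun_eq_pi_map hae
  simp only [(hg _).map_eq] at hmap
  have hmeas : Measurable fun y : S → ℝ ↦ ENNReal.ofReal
      (‖∑ A, (∏ s ∈ A, y s) • c A‖ ^ (2 * m)) :=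
    (Continuous.measurable (by fun_prop)).ennreal_ofReal
  have h := lmarginal_norm_multilinear_pow_le m (Finset.univ : Finset S) 0 c
  rw [← lintegral_eq_lmarginal_univ, ← hmap] at h
  simp only [Finset.powerset_univ] at h
  rwa [lintegral_map' hmeas.aemeasurable (aemeasurable_pi_lambda _ hae)] at h

theorem aemeasurable_gaussian_chaos {g : S → Ω → ℝ} (hg : ∀ s, AEMeasurable (g s) P) {k : ℕ}
    (c : {A : Finset S // A.card ≤ k} → H) :
    AEMeasurable (fun ω ↦ ‖∑ A, (∏ s ∈ A.1, g s ω) • c A‖) P := by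
  have : Measurable fun y : S → ℝ ↦ ‖∑ A, (∏ s ∈ A.1, y s) • c A‖ :=
    Continuous.measurable (by fun_prop)
  exact this.comp_aemeasurable (aemeasurable_pi_lambda _ hg)

theorem sum_eq_sum_subtype_of_eq_zero {ι M : Type*} [Fintype ι] [AddCommMonoid M]
    {p : ι → Prop} [DecidablePred p] (F : ι → M) (hF : ∀ i, ¬ p i → F i = 0) :
    ∑ i, F i = ∑ i : {i // p i}, F i.1 := by
  rw [← Finset.sum_subtype (Finset.univ.filter p) (by simp) F,
    Finset.sum_filter_of_ne fun i _ h ↦ by_contra fun hp ↦ h (hF i hp)]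

theorem lintegral_norm_gaussian_chaos_pow_le {g : S → Ω → ℝ}
    (hg : ∀ s, HasLaw (g s) (gaussianReal 0 1) P) (hind : iIndepFun g P) {k m : ℕ} (hm : 1 ≤ m)
    (c : {A : Finset S // A.card ≤ k} → H) :
    ∫⁻ ω, ENNReal.ofReal (‖∑ A, (∏ s ∈ A.1, g s ω) • c A‖ ^ (2 * m)) ∂P
      ≤ ENNReal.ofReal (((2 * m) ^ k * ∑ A, ‖c A‖ ^ 2) ^ m) := by
  classical
  let d : Finset S → H := fun A ↦ if h : A.card ≤ k then c ⟨A, h⟩ else 0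
  have hd : ∀ A : {A : Finset S // A.card ≤ k}, d A.1 = c A := fun A ↦ dif_pos A.2
  have hd0 : ∀ A : Finset S, ¬ A.card ≤ k → d A = 0 := fun A hA ↦ dif_neg hA
  have h := lintegral_norm_gaussian_multilinear_pow_le hg hind m d
  have e : ∀ ω, ∑ A, (∏ s ∈ A, g s ω) • d A
      = ∑ A : {A : Finset S // A.card ≤ k}, (∏ s ∈ A.1, g s ω) • c A := by
    intro ω
    rw [sum_eq_sum_subtype_of_eq_zero (p := fun A : Finset S ↦ A.card ≤ k) _
      fun A hA ↦ by rw [hd0 A hA, smul_zero]]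
    simp only [hd]
  simp only [e] at h
  rw [sum_eq_sum_subtype_of_eq_zero (p := fun A : Finset S ↦ A.card ≤ k) _
      fun A hA ↦ by rw [hd0 A hA]; simp] at h
  refine h.trans (ENNReal.ofReal_le_ofReal ?_)
  simp only [Finset.mul_sum, hd]
  have h1 : (1 : ℝ) ≤ 2 * m := by
    have : (1 : ℝ) ≤ m := by exact_mod_cast hm
    linarith
  gcongr with A
  exact A.2

theorem lintegral_rpow_le_rpow_lintegral_rpow [IsProbabilityMeasure P] {X : Ω → ℝ}
    (hX : AEMeasurable X P)
    (hX0 : ∀ ω, 0 ≤ X ω) {p q : ℝ} (hp : 0 < p) (hpq : p ≤ q) :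
    ∫⁻ ω, ENNReal.ofReal (X ω ^ p) ∂P ≤ (∫⁻ ω, ENNReal.ofReal (X ω ^ q) ∂P) ^ (p / q) := by
  have hq : 0 < q := hp.trans_le hpq
  have h := eLpNorm'_le_eLpNorm'_of_exponent_le hp hpq P hX.aestronglyMeasurable
  have he : ∀ {r : ℝ}, 0 < r → ∀ ω, ‖X ω‖ₑ ^ r = ENNReal.ofReal (X ω ^ r) := fun hr ω ↦ by
    rw [Real.enorm_of_nonneg (hX0 ω), ENNReal.ofReal_rpow_of_nonneg (hX0 ω) hr.le]
  simp only [eLpNorm', he hp, he hq] at h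
  have h2 := ENNReal.rpow_le_rpow h hp.le
  rwa [← ENNReal.rpow_mul, ← ENNReal.rpow_mul, one_div_mul_cancel hp.ne', ENNReal.rpow_one,
    one_div_mul_eq_div] at h2

theorem lintegral_norm_gaussian_chaos_rpow_le [IsProbabilityMeasure P] {g : S → Ω → ℝ}
    (hg : ∀ s, HasLaw (g s) (gaussianReal 0 1) P) (hind : iIndepFun g P) {k : ℕ}
    (c : {A : Finset S // A.card ≤ k} → H) {p : ℝ} (hp : 2 ≤ p) :
    ∫⁻ ω, ENNReal.ofReal (‖∑ A, (∏ s ∈ A.1, g s ω) • c A‖ ^ p) ∂P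
      ≤ ENNReal.ofReal ((2 * p) ^ ((k : ℝ) * p / 2) * (∑ A, ‖c A‖ ^ 2) ^ (p / 2)) := by
  -- The least `m` with `p ≤ 2m`; then `2m < p + 2 ≤ 2p`, the source of the constant `2`.
  set m := ⌈p / 2⌉₊ with hm
  have hm1 : p / 2 ≤ m := Nat.le_ceil _
  have hm2 : (m : ℝ) < p / 2 + 1 := Nat.ceil_lt_add_one (by linarith)
  have hm3 : 1 ≤ m := Nat.one_le_ceil_iff.2 (by linarith)
  have hm0 : (m : ℝ) ≠ 0 := by positivity
  have hσ : 0 ≤ ∑ A, ‖c A‖ ^ 2 := Finset.sum_nonneg fun _ _ ↦ by positivity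
  have hB : 0 ≤ (2 * (m : ℝ)) ^ k * ∑ A, ‖c A‖ ^ 2 := by positivity
  have h := lintegral_norm_gaussian_chaos_pow_le hg hind hm3 c
  refine (lintegral_rpow_le_rpow_lintegral_rpow
    (aemeasurable_gaussian_chaos (fun s ↦ (hg s).aemeasurable) c) (fun _ ↦ norm_nonneg _)
    (by linarith) (show p ≤ ((2 * m : ℕ) : ℝ) by push_cast; linarith)).trans ?_
  simp only [Real.rpow_natCast]
  refine (ENNReal.rpow_le_rpow h (by positivity)).trans ?_
  rw [ENNReal.ofReal_rpow_of_nonneg (by positivity) (by positivity)]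
  refine ENNReal.ofReal_le_ofReal ?_
  have e : (((2 * (m : ℝ)) ^ k * ∑ A, ‖c A‖ ^ 2) ^ m) ^ (p / ((2 * m : ℕ) : ℝ))
      = (2 * m) ^ ((k : ℝ) * p / 2) * (∑ A, ‖c A‖ ^ 2) ^ (p / 2) := by
    rw [← Real.rpow_natCast _ m, ← Real.rpow_mul hB,
      show (m : ℝ) * (p / ((2 * m : ℕ) : ℝ)) = p / 2 by push_cast; field_simp,
      Real.mul_rpow (by positivity) hσ, ← Real.rpow_natCast _ k, ← Real.rpow_mul (by positivity),
      mul_div_assoc]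
  rw [e]
  gcongr
  linarith

end Chaos

theorem corollary2p6 :
    ∃ C : ℝ, 0 < C ∧
      ∀ {Ω : Type*} [MeasurableSpace Ω] (P : Measure Ω) [IsProbabilityMeasure P]
        {S : Type*} [Fintype S]
        {H : Type*} [NormedAddCommGroup H] [InnerProductSpace ℂ H] [FiniteDimensional ℂ H]
        (g : S → Ω → ℝ) (_ : ∀ s, HasLaw (g s) (gaussianReal 0 1) P) (_ : iIndepFun g P)
        (k : ℕ) (c : {A : Finset S // A.card ≤ k} → H)
        (p : ℝ) (_ : 2 ≤ p),
        Integrable (fun ω => ‖∑ A, ((∏ s ∈ A.1, g s ω : ℝ) : ℂ) • c A‖ ^ p) P ∧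
        ∫ ω, ‖∑ A, ((∏ s ∈ A.1, g s ω : ℝ) : ℂ) • c A‖ ^ p ∂P
          ≤ (C * p) ^ ((k : ℝ) * p / 2) * (∑ A, ‖c A‖ ^ 2) ^ (p / 2) := by
  refine ⟨2, two_pos, ?_⟩
  intro Ω _ P _ S _ H _ _ _ g hg hind k c p hp
  -- The real part of the inner product induces the same norm, so the real estimate applies.
  let : InnerProductSpace ℝ H := InnerProductSpace.rclikeToReal ℂ H
  have hreal : ∀ (r : ℝ) (v : H), (r : ℂ) • v = r • v := fun _ _ ↦ rfl
  simp only [hreal]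
  have hle := lintegral_norm_gaussian_chaos_rpow_le hg hind c hp
  have hmeas := ((aemeasurable_gaussian_chaos (P := P) (fun s ↦ (hg s).aemeasurable) c).pow_const
    p).aestronglyMeasurable
  have hnn : ∀ ω, 0 ≤ ‖∑ A, (∏ s ∈ A.1, g s ω) • c A‖ ^ p := fun _ ↦ by positivity
  refine ⟨(lintegral_ofReal_ne_top_iff_integrable hmeas (ae_of_all _ hnn)).1
    (hle.trans_lt ENNReal.ofReal_lt_top).ne, ?_⟩
  rw [integral_eq_lintegral_of_nonneg_ae (ae_of_all _ hnn) hmeas]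
  exact ENNReal.toReal_le_of_le_ofReal (by positivity) hle
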